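/- Let $\mathbb{H}=\{z\in\mathbb{C}:\operatorname{Im} z>0\}$ and let $f:\mathbb{H}\to\mathbb{H}$ be holomorphic without fixed points, with Denjoy–Wolff point $\infty$ (that is, $f^n(z)\to\infty$ as $n\to\infty$ for every $z\in\mathbb{H}$, where $f^n$ is the $n$-th iterate). Suppose that $f$ is hyperbolic, i.e. the angular derivative $$\alpha=f'(\infty):=\angle\lim_{z\to\infty}\frac{f(z)}{z}$$ (the limit as $z\to\infty$ within each sector $\{z \in \mathbb{H}: |\operatorname{Re} z|\le a\operatorname{Im} z\}$, $a>0$) is a real number with $\alpha>1$. Then the following are equivalent: (a) $f$ is of extremal rate, i.e. for some $z\in\mathbb{H}$ the limit $\lim_{n\to\infty} f^n(z)/\alpha^n$ exists and lies in $\mathbb{H}$; (a') for every $z\in\mathbb{H}$ the limit $\lim_{n\to\infty} f^n(z)/\alpha^n$ exists and lies in $\mathbb{H}$; (b) $\displaystyle\int_1^{\infty}\left|\frac{f(iy)-i\alpha y}{y^2}\right|dy<\infty$; (c) $\displaystyle\int_1^{\infty}\frac{\operatorname{Im} f(iy)-\alpha y}{y^2}\,dy<\infty$, that is, this (non-negative)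 integrand is Lebesgue integrable on $(1,\infty)$. -/

import Mathlib

open Filter Topology MeasureTheory UpperHalfPlane

/-- The closed sector `|Re z| ≤ a Im z` of the upper half-plane. The sectors with `a > 0` exhaust
the non-tangential approach regions at infinity. -/
def upperSector (a : ℝ) : Set ℂ :=
  {z | z ∈ upperHalfPlaneSet ∧ |z.re| ≤ a * z.im}

/-- The angular (non-tangential) limit of `g` at infinity exists and equals `l`:
`g z → l` as `z → ∞` inside every sector `|Re z| ≤ a Im z`. -/
def HasAngularLimitAtInfty (g : ℂ → ℂ) (l : ℂ) : Prop :=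
  ∀ a : ℝ, 0 < a → Tendsto g (Bornology.cobounded ℂ ⊓ 𝓟 (upperSector a)) (𝓝 l)

/-- The angular derivative `f'(∞) = ∠lim f(z) / z` exists and equals the real number `α`. -/
def HasAngularDerivAtInfty (f : ℂ → ℂ) (α : ℝ) : Prop :=
  HasAngularLimitAtInfty (fun z => f z / z) (α : ℂ)

/-- `f` restricts to a holomorphic self-map of the upper half-plane. The values of `f` elsewhere
are irrelevant. -/
structure IsHolomorphicSelfMap (f : ℂ → ℂ) : Prop where
  mapsTo : Set.MapsTo f upperHalfPlaneSet upperHalfPlaneSet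
  differentiableOn : DifferentiableOn ℂ f upperHalfPlaneSet

/-- A non-elliptic holomorphic self-map of the upper half-plane: it has no fixed point there. -/
structure IsNonElliptic (f : ℂ → ℂ) : Prop extends IsHolomorphicSelfMap f where
  ne_self : ∀ z ∈ upperHalfPlaneSet, f z ≠ z

/-- The Denjoy–Wolff point of `f` is infinity: every orbit in the upper half-plane tends to
infinity. -/
def HasDenjoyWolffPointInfty (f : ℂ → ℂ) : Prop :=
  ∀ z ∈ upperHalfPlaneSet, Tendsto (fun n : ℕ => f^[n] z) atTop (Bornology.cobounded ℂ)

/-- `f` is a hyperbolic self-map of the upper half-plane with Denjoy–Wolff point infinity, and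
`α = f'(∞) > 1`. -/
structure IsHyperbolicAtInfty (f : ℂ → ℂ) (α : ℝ) : Prop extends IsNonElliptic f where
  denjoyWolff : HasDenjoyWolffPointInfty f
  angularDeriv : HasAngularDerivAtInfty f α
  one_lt : 1 < α

/-- The limit of `fⁿ(z) / αⁿ` exists and is a point of the upper half-plane. -/
def HasExtremalRateAt (f : ℂ → ℂ) (α : ℝ) (z : ℂ) : Prop :=
  ∃ L ∈ upperHalfPlaneSet, Tendsto (fun n : ℕ => f^[n] z / (α : ℂ) ^ n) atTop (𝓝 L)

/-- A hyperbolic self-map `f` with `f'(∞) = α` is of extremal rate: the limit of `fⁿ(z) / αⁿ`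
exists in the upper half-plane for some `z`. -/
def IsOfExtremalRate (f : ℂ → ℂ) (α : ℝ) : Prop :=
  ∃ z ∈ upperHalfPlaneSet, HasExtremalRateAt f α z

/-! ### Schwarz–Pick in the upper half-plane -/

/-! Everything rests on the displacement `p z = f z - α z`. Julia's lemma gives `Im p ≥ 0`, so
Schwarz–Pick for `p` is a Harnack inequality: between points at bounded hyperbolic distance, `Im p`
is comparable and the oscillation of `p` is at most a constant times `Im p`. Hence the integrals
over `(1, ∞)` can be replaced by series sampled at `i αⁿ`, and summability of `Im p(i αⁿ) / αⁿ`
already forces that of `|p(i αⁿ)| / αⁿ`.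

The increments of `fⁿ(z) / αⁿ` are `p(fⁿ z) / αⁿ⁺¹`. If the orbit stays at bounded hyperbolic
distance from `i αⁿ`, Harnack moves the series between the orbit and the axis. Under extremal rate
this closeness is immediate; conversely, it follows from summability because `f` contracts the
hyperbolic metric. -/

theorem Complex.norm_sub_conj_sq (u v : ℂ) :
    ‖u - (starRingEnd ℂ) v‖ ^ 2 = ‖u - v‖ ^ 2 + 4 * (u.im * v.im) := by
  rw [← Complex.normSq_eq_norm_sq, ← Complex.normSq_eq_norm_sq]
  simp only [Complex.normSq_apply, Complex.sub_re, Complex.sub_im, Complex.conj_re,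
    Complex.conj_im]
  ring

theorem Complex.sub_conj_ne_zero {u v : ℂ} (hu : 0 < u.im) (hv : 0 < v.im) :
    u - (starRingEnd ℂ) v ≠ 0 := by
  intro h
  have := congrArg Complex.im h
  simp at this
  linarith

theorem Complex.norm_cayley_lt_one {u v : ℂ} (hu : 0 < u.im) (hv : 0 < v.im) :
    ‖(u - v) / (u - (starRingEnd ℂ) v)‖ < 1 := by
  rw [norm_div, div_lt_one (norm_pos_iff.2 (Complex.sub_conj_ne_zero hu hv))]
  refine lt_of_pow_lt_pow_left₀ 2 (norm_nonneg _) ?_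
  rw [Complex.norm_sub_conj_sq]
  have := mul_pos hu hv
  linarith

theorem Complex.one_sub_ne_zero_of_norm_lt_one {ζ : ℂ} (hζ : ‖ζ‖ < 1) : 1 - ζ ≠ 0 := by
  intro h
  rw [← sub_eq_zero.1 h] at hζ
  simp at hζ

theorem Complex.im_cayley_symm_pos {w ζ : ℂ} (hw : 0 < w.im) (hζ : ‖ζ‖ < 1) :
    0 < ((w - (starRingEnd ℂ) w * ζ) / (1 - ζ)).im := by
  have h1 : 0 < Complex.normSq (1 - ζ) :=
    Complex.normSq_pos.2 (Complex.one_sub_ne_zero_of_norm_lt_one hζ)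
  have h2 : Complex.normSq ζ < 1 := by
    rw [Complex.normSq_eq_norm_sq]
    exact pow_lt_one₀ (norm_nonneg _) hζ two_ne_zero
  have h3 : ((w - (starRingEnd ℂ) w * ζ) / (1 - ζ)).im
      = w.im * (1 - Complex.normSq ζ) / Complex.normSq (1 - ζ) := by
    rw [Complex.div_im, ← sub_div]
    congr 1
    simp only [Complex.normSq_apply, Complex.sub_re, Complex.sub_im, Complex.mul_re,
      Complex.mul_im, Complex.conj_re, Complex.conj_im, Complex.one_re, Complex.one_im]
    ring
  rw [h3]
  exact div_pos (mul_pos hw (by linarith)) h1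

/-- The Schwarz lemma on the disc, transported by Cayley maps centred at `w` and `f w`. After
squaring, `Complex.norm_sub_conj_sq` makes the product terms cancel. -/
theorem schwarz_pick {f : ℂ → ℂ} (hm : Set.MapsTo f upperHalfPlaneSet upperHalfPlaneSet)
    (hd : DifferentiableOn ℂ f upperHalfPlaneSet) {z w : ℂ} (hz : 0 < z.im) (hw : 0 < w.im) :
    ‖f z - f w‖ ^ 2 * (z.im * w.im) ≤ ‖z - w‖ ^ 2 * ((f z).im * (f w).im) := by
  have hfz : 0 < (f z).im := hm hz
  have hfw : 0 < (f w).im := hm hw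
  let φ : ℂ → ℂ := fun ζ => (w - (starRingEnd ℂ) w * ζ) / (1 - ζ)
  let g : ℂ → ℂ := fun ζ => (f (φ ζ) - f w) / (f (φ ζ) - (starRingEnd ℂ) (f w))
  have hφm : Set.MapsTo φ (Metric.ball 0 1) upperHalfPlaneSet := fun ζ hζ =>
    Complex.im_cayley_symm_pos hw (mem_ball_zero_iff.1 hζ)
  have hφd : DifferentiableOn ℂ φ (Metric.ball 0 1) := by
    refine DifferentiableOn.div (by fun_prop) (by fun_prop) fun ζ hζ => ?_
    exact Complex.one_sub_ne_zero_of_norm_lt_one (mem_ball_zero_iff.1 hζ)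
  have hfφ : DifferentiableOn ℂ (fun ζ => f (φ ζ)) (Metric.ball 0 1) := hd.comp hφd hφm
  have hgd : DifferentiableOn ℂ g (Metric.ball 0 1) :=
    (hfφ.sub_const _).div (hfφ.sub_const _) fun ζ hζ =>
      Complex.sub_conj_ne_zero (hm (hφm hζ)) hfw
  have hgm : Set.MapsTo g (Metric.ball 0 1) (Metric.closedBall 0 1) := fun ζ hζ =>
    mem_closedBall_zero_iff.2 (Complex.norm_cayley_lt_one (hm (hφm hζ)) hfw).le
  have hg0 : g 0 = 0 := by simp [g, φ]
  have hζ1 := Complex.norm_cayley_lt_one hz hw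
  have hzw := Complex.sub_conj_ne_zero hz hw
  have hww := Complex.sub_conj_ne_zero hw hw
  have hφζ : φ ((z - w) / (z - (starRingEnd ℂ) w)) = z := by
    have h := Complex.one_sub_ne_zero_of_norm_lt_one hζ1
    simp only [φ]
    rw [div_eq_iff h]
    field_simp
    ring
  have key := Complex.norm_le_norm_of_mapsTo_ball hgd hgm hg0 hζ1
  simp only [g, hφζ, norm_div] at key
  have hA := norm_pos_iff.2 (Complex.sub_conj_ne_zero hfz hfw)
  have hB := norm_pos_iff.2 hzw
  rw [div_le_div_iff₀ hA hB] at key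
  have key2 := pow_le_pow_left₀ (by positivity) key 2
  rw [mul_pow, mul_pow, Complex.norm_sub_conj_sq, Complex.norm_sub_conj_sq] at key2
  linarith

/-- Values on the real line are allowed: apply Schwarz–Pick to `p + iε` and let `ε → 0`. -/
theorem schwarz_pick_of_im_nonneg {p : ℂ → ℂ} (hm : ∀ z : ℂ, 0 < z.im → 0 ≤ (p z).im)
    (hd : DifferentiableOn ℂ p upperHalfPlaneSet) {z w : ℂ} (hz : 0 < z.im) (hw : 0 < w.im) :
    ‖p z - p w‖ ^ 2 * (z.im * w.im) ≤ ‖z - w‖ ^ 2 * ((p z).im * (p w).im) := by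
  have h : ∀ ε : ℝ, 0 < ε → ‖p z - p w‖ ^ 2 * (z.im * w.im)
      ≤ ‖z - w‖ ^ 2 * (((p z).im + ε) * ((p w).im + ε)) := by
    intro ε hε
    have := schwarz_pick (f := fun z => p z + ε * Complex.I)
      (fun u hu => by
        have := hm u hu
        simp only [upperHalfPlaneSet, Set.mem_ofPred_eq, Complex.add_im, Complex.mul_im,
          Complex.ofReal_re, Complex.ofReal_im, Complex.I_re, Complex.I_im]
        linarith) (hd.add_const _) hz hw
    simpa using this
  have ht : Tendsto (fun ε : ℝ => ‖z - w‖ ^ 2 * (((p z).im + ε) * ((p w).im + ε))) (𝓝[>] 0)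
      (𝓝 (‖z - w‖ ^ 2 * (((p z).im + 0) * ((p w).im + 0)))) := by
    refine Tendsto.mono_left (Continuous.tendsto ?_ 0) nhdsWithin_le_nhds
    fun_prop
  simp only [add_zero] at ht
  exact ge_of_tendsto ht (eventually_mem_nhdsWithin.mono h)

theorem le_mul_of_sub_sq_le {a b M : ℝ} (ha : 0 ≤ a) (hb : 0 ≤ b) (hM : 0 ≤ M)
    (h : (a - b) ^ 2 ≤ M * (a * b)) : a ≤ (M + 2) * b := by
  rcases ha.eq_or_lt with rfl | ha
  · positivity
  · refine le_of_mul_le_mul_left ?_ ha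
    nlinarith [sq_nonneg b]

/-- Harnack's inequality, with a bound on the oscillation, between points at bounded hyperbolic
distance. -/
theorem harnack_of_im_nonneg {p : ℂ → ℂ} (hm : ∀ z : ℂ, 0 < z.im → 0 ≤ (p z).im)
    (hd : DifferentiableOn ℂ p upperHalfPlaneSet) {z w : ℂ} (hz : 0 < z.im) (hw : 0 < w.im)
    {M : ℝ} (hM : 0 ≤ M) (h : ‖z - w‖ ^ 2 ≤ M * (z.im * w.im)) :
    (p z).im ≤ (M + 2) * (p w).im ∧ ‖p z - p w‖ ≤ (M + 2) * (p w).im := by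
  have ha := hm z hz
  have hb := hm w hw
  have hzw : 0 < z.im * w.im := mul_pos hz hw
  have h1 : ‖p z - p w‖ ^ 2 ≤ M * ((p z).im * (p w).im) := by
    refine le_of_mul_le_mul_right ?_ hzw
    calc _ ≤ ‖z - w‖ ^ 2 * ((p z).im * (p w).im) := schwarz_pick_of_im_nonneg hm hd hz hw
      _ ≤ M * (z.im * w.im) * ((p z).im * (p w).im) := by gcongr
      _ = _ := by ring
  have h2 : (p z).im ≤ (M + 2) * (p w).im := by
    refine le_mul_of_sub_sq_le ha hb hM (le_trans ?_ h1)
    rw [← Complex.sub_im, ← sq_abs]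
    gcongr
    exact Complex.abs_im_le_norm _
  refine ⟨h2, abs_le_of_sq_le_sq' ?_ (by positivity) |>.2⟩
  calc ‖p z - p w‖ ^ 2 ≤ M * ((p z).im * (p w).im) := h1
    _ ≤ M * ((M + 2) * (p w).im * (p w).im) := by gcongr
    _ ≤ (M + 2) * ((M + 2) * (p w).im * (p w).im) := by gcongr; linarith
    _ = _ := by ring

theorem dist_map_le_of_mapsTo_upperHalfPlane {f : ℂ → ℂ}
    (hm : Set.MapsTo f upperHalfPlaneSet upperHalfPlaneSet)
    (hd : DifferentiableOn ℂ f upperHalfPlaneSet) {z w : ℂ} (hz : 0 < z.im) (hw : 0 < w.im) :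
    dist (⟨f z, hm hz⟩ : ℍ) ⟨f w, hm hw⟩ ≤ dist (⟨z, hz⟩ : ℍ) ⟨w, hw⟩ := by
  have hfz : 0 < (f z).im := hm hz
  have hfw : 0 < (f w).im := hm hw
  rw [UpperHalfPlane.dist_eq, UpperHalfPlane.dist_eq]
  refine mul_le_mul_of_nonneg_left (Real.arsinh_le_arsinh.2 ?_) zero_le_two
  have h := schwarz_pick hm hd hz hw
  rw [Complex.dist_eq, Complex.dist_eq]
  change ‖f z - f w‖ / (2 * √((f z).im * (f w).im)) ≤ ‖z - w‖ / (2 * √(z.im * w.im))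
  have h1 := mul_pos hz hw
  have h2 := mul_pos hfz hfw
  rw [div_le_div_iff₀ (by positivity) (by positivity)]
  refine abs_le_of_sq_le_sq' ?_ (by positivity) |>.2
  rw [mul_pow, mul_pow, mul_pow, mul_pow, Real.sq_sqrt h1.le, Real.sq_sqrt h2.le]
  linarith

/-! ### Sampling along a geometric progression -/

/-- The block `[αⁿ, αⁿ⁺¹]` has length `(α - 1) αⁿ`, so it contributes at most `(α - 1) c n / αⁿ`. -/
theorem integrableOn_Ioi_one_of_geometric_bound {α : ℝ} (hα : 1 < α) {h : ℝ → ℝ} {c : ℕ → ℝ}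
    (hc : ContinuousOn h (Set.Ici 1)) (hs : Summable fun n => c n / α ^ n)
    (hb : ∀ n, ∀ y ∈ Set.Icc (α ^ n) (α ^ (n + 1)), |h y| ≤ c n / (α ^ n) ^ 2) :
    IntegrableOn h (Set.Ioi 1) := by
  have hpos : ∀ n : ℕ, 0 < α ^ n := fun n => pow_pos (by linarith) n
  have hle : ∀ n : ℕ, α ^ n ≤ α ^ (n + 1) := fun n => pow_le_pow_right₀ hα.le n.le_succ
  have hsub : Set.Ioi 1 ⊆ ⋃ n : ℕ, Set.Icc (α ^ n) (α ^ (n + 1)) := by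
    intro y hy
    obtain ⟨n, h1, h2⟩ := exists_nat_pow_near (le_of_lt hy) hα
    exact Set.mem_iUnion.2 ⟨n, h1, h2.le⟩
  refine IntegrableOn.mono_set ?_ hsub
  have hi : ∀ n : ℕ, IntegrableOn h (Set.Icc (α ^ n) (α ^ (n + 1))) := fun n =>
    (hc.mono fun y hy => (one_le_pow₀ hα.le).trans hy.1).integrableOn_Icc
  refine integrableOn_iUnion_of_summable_integral_norm hi ?_
  refine Summable.of_nonneg_of_le (fun n => integral_nonneg fun _ => norm_nonneg _) (fun n => ?_)
    (hs.mul_left (α - 1))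
  calc ∫ y in Set.Icc (α ^ n) (α ^ (n + 1)), ‖h y‖
      ≤ ∫ y in Set.Icc (α ^ n) (α ^ (n + 1)), c n / (α ^ n) ^ 2 :=
        setIntegral_mono_on (hi n).norm (integrableOn_const (by simp)) measurableSet_Icc (hb n)
    _ = (α ^ (n + 1) - α ^ n) * (c n / (α ^ n) ^ 2) := by
        rw [setIntegral_const, Real.volume_real_Icc_of_le (hle n), smul_eq_mul]
    _ = (α - 1) * (c n / α ^ n) := by
        have := (hpos n).ne'
        field_simp
        ring

theorem summable_of_integrableOn_Ioi_one {α : ℝ} (hα : 1 < α) {h : ℝ → ℝ} {c : ℕ → ℝ}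
    (hi : IntegrableOn h (Set.Ioi 1)) (h0 : ∀ n, 0 ≤ c n)
    (hb : ∀ n, ∀ y ∈ Set.Ioc (α ^ n) (α ^ (n + 1)), c n / (α ^ n) ^ 2 ≤ h y) :
    Summable fun n => c n / α ^ n := by
  have hpos : ∀ n : ℕ, 0 < α ^ n := fun n => pow_pos (by linarith) n
  have hle : ∀ n : ℕ, α ^ n ≤ α ^ (n + 1) := fun n => pow_le_pow_right₀ hα.le n.le_succ
  have hsub : ∀ n : ℕ, Set.Ioc (α ^ n) (α ^ (n + 1)) ⊆ Set.Ioi 1 := fun n y hy =>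
    (one_le_pow₀ hα.le).trans_lt hy.1
  have hsum := (hasSum_integral_iUnion (fun n => measurableSet_Ioc)
    (pow_right_mono₀ hα.le).pairwise_disjoint_on_Ioc_succ
    (hi.mono_set (Set.iUnion_subset hsub))).summable
  refine Summable.of_nonneg_of_le (fun n => div_nonneg (h0 n) (hpos n).le) (fun n => ?_)
    (hsum.mul_left (α - 1)⁻¹)
  rw [← div_eq_inv_mul, le_div_iff₀ (by linarith)]
  calc c n / α ^ n * (α - 1) = (α ^ (n + 1) - α ^ n) * (c n / (α ^ n) ^ 2) := by
        have := (hpos n).ne'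
        field_simp
        ring
    _ = ∫ y in Set.Ioc (α ^ n) (α ^ (n + 1)), c n / (α ^ n) ^ 2 := by
        rw [setIntegral_const, Real.volume_real_Ioc_of_le (hle n), smul_eq_mul]
    _ ≤ _ := setIntegral_mono_on (integrableOn_const (by simp)) (hi.mono_set (hsub n))
        measurableSet_Ioc (hb n)

/-- Summing the recursion bounds `1 - r` times each partial sum of `a` by `a 0 + ∑ e`. -/
theorem summable_of_le_mul_add {a e : ℕ → ℝ} {r : ℝ} (ha : ∀ n, 0 ≤ a n) (he0 : ∀ n, 0 ≤ e n)
    (he : Summable e) (hr : r < 1) (h : ∀ n, a (n + 1) ≤ r * a n + e n) :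
    Summable a := by
  refine summable_of_sum_range_le (c := (a 0 + ∑' n, e n) / (1 - r)) ha fun n => ?_
  rw [le_div_iff₀ (by linarith)]
  have h1 : ∑ i ∈ Finset.range n, a (i + 1)
      ≤ r * ∑ i ∈ Finset.range n, a i + ∑ i ∈ Finset.range n, e i := by
    rw [Finset.mul_sum, ← Finset.sum_add_distrib]
    exact Finset.sum_le_sum fun i _ => h i
  have h2 := Finset.sum_range_succ a n
  have h3 := Finset.sum_range_succ' a n
  have h4 := he.sum_le_tsum (Finset.range n) fun i _ => he0 i
  have h5 := ha n
  linarith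

/-! ### The displacement `f z - α z` -/

theorem HasAngularDerivAtInfty.tendsto_imaginary_axis {f : ℂ → ℂ} {α : ℝ}
    (h : HasAngularDerivAtInfty f α) :
    Tendsto (fun y : ℝ => f (Complex.I * y) / y) atTop (𝓝 (Complex.I * α)) := by
  have h1 : Tendsto (fun y : ℝ => Complex.I * (y : ℂ)) atTop
      (Bornology.cobounded ℂ ⊓ 𝓟 (upperSector 1)) := by
    refine tendsto_inf.2 ⟨?_, ?_⟩
    · rw [← tendsto_norm_atTop_iff_cobounded]
      simpa using tendsto_abs_atTop_atTop
    · refine tendsto_principal.2 ((eventually_gt_atTop 0).mono fun y hy => ?_)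
      refine ⟨?_, ?_⟩
      · simpa [upperHalfPlaneSet] using hy
      · simpa using hy.le
  refine (((h 1 one_pos).comp h1).const_mul Complex.I).congr' ?_
  filter_upwards [eventually_gt_atTop 0] with y hy
  have : (y : ℂ) ≠ 0 := by exact_mod_cast hy.ne'
  simp only [Function.comp_apply]
  field_simp [Complex.I_ne_zero]

/-- Julia's lemma at infinity. -/
theorem IsHolomorphicSelfMap.mul_im_le_im {f : ℂ → ℂ} {α : ℝ} (hf : IsHolomorphicSelfMap f)
    (hα : 0 < α) (h : HasAngularDerivAtInfty f α) {z : ℂ} (hz : 0 < z.im) :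
    α * z.im ≤ (f z).im := by
  have hu := h.tendsto_imaginary_axis
  have h0 : ∀ c : ℂ, Tendsto (fun y : ℝ => c / (y : ℂ)) atTop (𝓝 0) := fun c =>
    tendsto_zero_iff_norm_tendsto_zero.2 (by
      simpa using tendsto_abs_atTop_atTop.const_div_atTop ‖c‖)
  -- Schwarz–Pick for `z` and `iy`, divided by `y³`, tends to `α² Im z ≤ α Im f(z)` as `y → ∞`.
  have hl : Tendsto (fun y : ℝ => ‖f z / y - f (Complex.I * y) / y‖ ^ 2 * z.im) atTop
      (𝓝 (‖0 - Complex.I * α‖ ^ 2 * z.im)) :=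
    ((((h0 _).sub hu).norm).pow 2).mul_const _
  have hr : Tendsto (fun y : ℝ => ‖z / y - Complex.I‖ ^ 2 *
      ((f z).im * (f (Complex.I * y) / y).im)) atTop
      (𝓝 (‖0 - Complex.I‖ ^ 2 * ((f z).im * (Complex.I * α).im))) :=
    ((((h0 _).sub_const _).norm).pow 2).mul
      (((Complex.continuous_im.tendsto _).comp hu).const_mul _)
  have hle := le_of_tendsto_of_tendsto hl hr (by
    filter_upwards [eventually_gt_atTop 0] with y hy
    have hy' : (y : ℂ) ≠ 0 := by exact_mod_cast hy.ne'
    have key := schwarz_pick hf.mapsTo hf.differentiableOn hz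
      (w := Complex.I * y) (by simpa using hy)
    have e1 : z / y - Complex.I = (z - Complex.I * y) / y := by field_simp
    rw [← sub_div, e1, norm_div, norm_div, Complex.div_ofReal_im, Complex.norm_real,
      Real.norm_of_nonneg hy.le]
    rw [Complex.I_mul_im, Complex.ofReal_re] at key
    have hy3 : 0 < y ^ 3 := by positivity
    refine le_of_mul_le_mul_right ?_ hy3
    calc _ = ‖f z - f (Complex.I * y)‖ ^ 2 * (z.im * y) := by field_simp
      _ ≤ _ := key
      _ = _ := by field_simp)
  simp at hle
  nlinarith

theorem IsHyperbolicAtInfty.im_sub_nonneg {f : ℂ → ℂ} {α : ℝ} (hf : IsHyperbolicAtInfty f α)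
    (z : ℂ) (hz : 0 < z.im) : 0 ≤ (f z - α * z).im := by
  have := hf.toIsHolomorphicSelfMap.mul_im_le_im (zero_lt_one.trans hf.one_lt) hf.angularDeriv hz
  simpa using this

theorem IsHyperbolicAtInfty.differentiableOn_sub {f : ℂ → ℂ} {α : ℝ}
    (hf : IsHyperbolicAtInfty f α) :
    DifferentiableOn ℂ (fun z => f z - α * z) upperHalfPlaneSet :=
  hf.differentiableOn.sub (by fun_prop)

section Displacement

variable {p : ℂ → ℂ} {α : ℝ}

theorem I_mul_pow_im_pos (hα : 1 < α) (n : ℕ) :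
    0 < (Complex.I * ((α ^ n : ℝ) : ℂ)).im := by
  rw [Complex.I_mul_im, Complex.ofReal_re]
  exact pow_pos (by linarith) n

theorem harnack_imaginary_axis (hm : ∀ z : ℂ, 0 < z.im → 0 ≤ (p z).im)
    (hd : DifferentiableOn ℂ p upperHalfPlaneSet) {s t : ℝ} (hs : 0 < s) (ht : 0 < t)
    (hα : 1 < α) (hst : s ≤ α * t) (hts : t ≤ α * s) :
    (p (Complex.I * s)).im ≤ (α + 2) * (p (Complex.I * t)).im ∧
      ‖p (Complex.I * s) - p (Complex.I * t)‖ ≤ (α + 2) * (p (Complex.I * t)).im := by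
  refine harnack_of_im_nonneg hm hd (by simpa using hs) (by simpa using ht) (by linarith) ?_
  rw [← mul_sub, ← Complex.ofReal_sub, norm_mul, Complex.norm_I, one_mul, Complex.norm_real,
    Real.norm_eq_abs, sq_abs, Complex.I_mul_im, Complex.I_mul_im, Complex.ofReal_re,
    Complex.ofReal_re]
  -- Here `(s - t)² ≤ max(s, t)² ≤ α s t`.
  rcases le_total s t with h | h <;> nlinarith [mul_pos hs ht]

theorem continuousOn_imaginary_axis (hd : DifferentiableOn ℂ p upperHalfPlaneSet) :
    ContinuousOn (fun y : ℝ => p (Complex.I * y)) (Set.Ici 1) :=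
  hd.continuousOn.comp (by fun_prop) fun y (hy : 1 ≤ y) => by
    simpa [upperHalfPlaneSet] using lt_of_lt_of_le one_pos hy

theorem summable_im_of_integrableOn (hm : ∀ z : ℂ, 0 < z.im → 0 ≤ (p z).im)
    (hd : DifferentiableOn ℂ p upperHalfPlaneSet) (hα : 1 < α)
    (hi : IntegrableOn (fun y : ℝ => (p (Complex.I * y)).im / y ^ 2) (Set.Ioi 1)) :
    Summable fun n : ℕ => (p (Complex.I * (α ^ n : ℝ))).im / α ^ n := by
  have h0 : ∀ n : ℕ, 0 ≤ (p (Complex.I * (α ^ n : ℝ))).im := fun n =>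
    hm _ (I_mul_pow_im_pos hα n)
  refine summable_of_integrableOn_Ioi_one hα (hi.const_mul ((α + 2) * α ^ 2)) h0
    fun n y hy => ?_
  have hn : 0 < α ^ n := pow_pos (by linarith) n
  have hy0 : 0 < y := hn.trans hy.1
  have hy2 : y ≤ α * α ^ n := by rw [← pow_succ']; exact hy.2
  have h1 := (harnack_imaginary_axis hm hd hn hy0 hα
    (hy.1.le.trans (le_mul_of_one_le_left hy0.le hα.le)) hy2).1
  have hpy := hm (Complex.I * y) (by simpa using hy0)
  rw [div_le_iff₀ (by positivity)]
  calc _ ≤ (α + 2) * (p (Complex.I * y)).im := h1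
    _ = (α + 2) * ((p (Complex.I * y)).im / y ^ 2) * y ^ 2 := by field_simp
    _ ≤ (α + 2) * ((p (Complex.I * y)).im / y ^ 2) * (α * α ^ n) ^ 2 := by gcongr
    _ = _ := by ring

/-- Harnack bounds the step from `p(i αⁿ)` to `p(i αⁿ⁺¹)` by `Im p(i αⁿ)`, up to a constant.
Dividing by `αⁿ⁺¹` turns this into a recursion with ratio `α⁻¹ < 1` and summable error. -/
theorem summable_norm_of_summable_im (hm : ∀ z : ℂ, 0 < z.im → 0 ≤ (p z).im)
    (hd : DifferentiableOn ℂ p upperHalfPlaneSet) (hα : 1 < α)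
    (hs : Summable fun n : ℕ => (p (Complex.I * (α ^ n : ℝ))).im / α ^ n) :
    Summable fun n : ℕ => ‖p (Complex.I * (α ^ n : ℝ))‖ / α ^ n := by
  have hα0 : 0 < α := by linarith
  have hpos : ∀ n : ℕ, 0 < α ^ n := fun n => pow_pos hα0 n
  refine summable_of_le_mul_add (r := α⁻¹) (fun n => by have := hpos n; positivity)
    (fun n => ?_) (hs.mul_left ((α + 2) * α⁻¹)) (inv_lt_one_of_one_lt₀ hα) fun n => ?_
  · have := div_nonneg (hm _ (I_mul_pow_im_pos hα n)) (hpos n).le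
    positivity
  · have hn := hpos n
    have h1 := (harnack_imaginary_axis hm hd (hpos (n + 1)) hn hα (pow_succ' α n).le
      ((pow_le_pow_right₀ hα.le n.le_succ).trans
        (le_mul_of_one_le_left (hpos _).le hα.le))).2
    have h2 := norm_le_norm_add_norm_sub' (p (Complex.I * (α ^ (n + 1) : ℝ)))
      (p (Complex.I * (α ^ n : ℝ)))
    rw [div_le_iff₀ (hpos _)]
    calc _ ≤ _ := h2.trans (add_le_add_right h1 _)
      _ = _ := by
        rw [pow_succ']
        field_simp

theorem integrableOn_norm_of_summable_im (hm : ∀ z : ℂ, 0 < z.im → 0 ≤ (p z).im)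
    (hd : DifferentiableOn ℂ p upperHalfPlaneSet) (hα : 1 < α)
    (hs : Summable fun n : ℕ => (p (Complex.I * (α ^ n : ℝ))).im / α ^ n) :
    IntegrableOn (fun y : ℝ => ‖p (Complex.I * y) / (y : ℂ) ^ 2‖) (Set.Ioi 1) := by
  have hsum := (summable_norm_of_summable_im hm hd hα hs).add (hs.mul_left (α + 2))
  refine integrableOn_Ioi_one_of_geometric_bound hα (c := fun n =>
    ‖p (Complex.I * (α ^ n : ℝ))‖ + (α + 2) * (p (Complex.I * (α ^ n : ℝ))).im) ?_
    (hsum.congr fun n => by ring) fun n y hy => ?_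
  · refine ((continuousOn_imaginary_axis hd).div (by fun_prop) fun y (hy : 1 ≤ y) => ?_).norm
    have : y ≠ 0 := by linarith
    exact_mod_cast pow_ne_zero 2 this
  · have hn : 0 < α ^ n := pow_pos (by linarith) n
    have hy0 : 0 < y := hn.trans_le hy.1
    have hy2 : y ≤ α * α ^ n := by rw [← pow_succ']; exact hy.2
    have h1 := (harnack_imaginary_axis hm hd hy0 hn hα hy2
      (hy.1.trans (le_mul_of_one_le_left hy0.le hα.le))).2
    have h2 := norm_le_norm_add_norm_sub' (p (Complex.I * y)) (p (Complex.I * (α ^ n : ℝ)))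
    rw [abs_norm, norm_div, norm_pow, Complex.norm_real, Real.norm_of_nonneg hy0.le]
    have h3 := h2.trans (add_le_add_right h1 _)
    exact div_le_div₀ ((norm_nonneg _).trans h3) h3 (by positivity)
      (pow_le_pow_left₀ hn.le hy.1 2)

theorem integrableOn_im_of_integrableOn_norm
    (hd : DifferentiableOn ℂ p upperHalfPlaneSet)
    (hi : IntegrableOn (fun y : ℝ => ‖p (Complex.I * y) / (y : ℂ) ^ 2‖) (Set.Ioi 1)) :
    IntegrableOn (fun y : ℝ => (p (Complex.I * y)).im / y ^ 2) (Set.Ioi 1) := by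
  refine Integrable.mono' hi ?_ ?_
  · refine ContinuousOn.aestronglyMeasurable ?_ measurableSet_Ioi
    refine (Complex.continuous_im.comp_continuousOn
      ((continuousOn_imaginary_axis hd).mono Set.Ioi_subset_Ici_self)).div (by fun_prop)
      fun y (hy : 1 < y) => ?_
    have : y ≠ 0 := by linarith
    exact pow_ne_zero 2 this
  · refine Eventually.of_forall fun y => ?_
    rw [norm_div, norm_div, norm_pow, norm_pow, Complex.norm_real]
    gcongr
    exact Complex.abs_im_le_norm _

end Displacement

/-! ### Orbits -/

section Orbits

variable {f : ℂ → ℂ} {α : ℝ}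

theorem IsHolomorphicSelfMap.iterate_im_pos (hf : IsHolomorphicSelfMap f) {z : ℂ}
    (hz : 0 < z.im) (n : ℕ) : 0 < (f^[n] z).im :=
  hf.mapsTo.iterate n hz

theorem iterate_succ_div_pow_sub (hα : 1 < α) (z : ℂ) (n : ℕ) :
    f^[n + 1] z / (α : ℂ) ^ (n + 1) - f^[n] z / (α : ℂ) ^ n
      = (f (f^[n] z) - α * f^[n] z) / (α : ℂ) ^ (n + 1) := by
  have : (α : ℂ) ≠ 0 := by exact_mod_cast (zero_lt_one.trans hα).ne'
  rw [Function.iterate_succ_apply', pow_succ']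
  field_simp

theorem im_div_ofReal_pow (w : ℂ) (n : ℕ) : (w / (α : ℂ) ^ n).im = w.im / α ^ n := by
  rw [← Complex.ofReal_pow, Complex.div_ofReal_im]

/-- Each application of `f` does not increase the distance to the axis point; replacing `f(i αᵏ)` by
`i αᵏ⁺¹` then costs at most `|p(i αᵏ)| / αᵏ`. -/
theorem IsHyperbolicAtInfty.dist_iterate_le (hf : IsHyperbolicAtInfty f α) {z : ℂ}
    (hz : 0 < z.im) (n : ℕ) :
    dist (⟨f^[n] z, hf.iterate_im_pos hz n⟩ : ℍ)
        ⟨Complex.I * (α ^ n : ℝ), I_mul_pow_im_pos hf.one_lt n⟩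
      ≤ dist (⟨z, hz⟩ : ℍ) UpperHalfPlane.I + ∑ k ∈ Finset.range n,
        ‖f (Complex.I * (α ^ k : ℝ)) - α * (Complex.I * (α ^ k : ℝ))‖ / α ^ k := by
  have hα := hf.one_lt
  have hα0 : 0 < α := by linarith
  induction n with
  | zero =>
    simp only [Finset.range_zero, Finset.sum_empty, add_zero]
    refine le_of_eq ?_
    congr 1
    ext
    simp
  | succ n ih =>
    have hn : 0 < α ^ n := pow_pos hα0 n
    have hn1 : 0 < α ^ (n + 1) := pow_pos hα0 _
    have hζ := I_mul_pow_im_pos hα n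
    set ζ : ℂ := Complex.I * (α ^ n : ℝ) with hζd
    have h1 := dist_map_le_of_mapsTo_upperHalfPlane hf.mapsTo hf.differentiableOn
      (hf.iterate_im_pos hz n) hζ
    have h2 := UpperHalfPlane.dist_le_dist_coe_div_sqrt (⟨f ζ, hf.mapsTo hζ⟩ : ℍ)
      ⟨Complex.I * (α ^ (n + 1) : ℝ), I_mul_pow_im_pos hα (n + 1)⟩
    have h3 : α ^ (n + 1) ≤ (f ζ).im := by
      have := hf.im_sub_nonneg ζ hζ
      rw [Complex.sub_im, Complex.im_ofReal_mul, hζd, Complex.I_mul_im, Complex.ofReal_re] at this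
      rw [pow_succ']
      exact sub_nonneg.1 this
    have e : Complex.I * ((α ^ (n + 1) : ℝ) : ℂ) = α * ζ := by
      rw [hζd, pow_succ]
      push_cast
      ring
    have h4 : dist (f ζ) (Complex.I * (α ^ (n + 1) : ℝ)) /
        √((f ζ).im * (Complex.I * ((α ^ (n + 1) : ℝ) : ℂ)).im) ≤ ‖f ζ - α * ζ‖ / α ^ n := by
      rw [Complex.dist_eq, Complex.I_mul_im, Complex.ofReal_re, e]
      -- By Julia's lemma both imaginary parts are at least `αⁿ⁺¹ ≥ αⁿ`.
      refine div_le_div_of_nonneg_left (norm_nonneg _) hn (Real.le_sqrt_of_sq_le ?_)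
      have h5 : α ^ n ≤ α ^ (n + 1) := pow_le_pow_right₀ hα.le n.le_succ
      nlinarith
    have h6 : dist (⟨f^[n + 1] z, hf.iterate_im_pos hz (n + 1)⟩ : ℍ) ⟨f ζ, hf.mapsTo hζ⟩
        = dist (⟨f (f^[n] z), hf.mapsTo (hf.iterate_im_pos hz n)⟩ : ℍ) ⟨f ζ, hf.mapsTo hζ⟩ := by
      congr 1
      ext
      exact Function.iterate_succ_apply' f n z
    have h7 := dist_triangle (⟨f^[n + 1] z, hf.iterate_im_pos hz (n + 1)⟩ : ℍ)
      ⟨f ζ, hf.mapsTo hζ⟩ ⟨Complex.I * (α ^ (n + 1) : ℝ), I_mul_pow_im_pos hα (n + 1)⟩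
    rw [Finset.sum_range_succ]
    have h8 := h2.trans h4
    linarith

theorem IsHyperbolicAtInfty.hasExtremalRateAt_of_summable (hf : IsHyperbolicAtInfty f α)
    (hs : Summable fun n : ℕ =>
      ‖f (Complex.I * (α ^ n : ℝ)) - α * (Complex.I * (α ^ n : ℝ))‖ / α ^ n)
    {z : ℂ} (hz : 0 < z.im) : HasExtremalRateAt f α z := by
  have hα := hf.one_lt
  have hα0 : 0 < α := by linarith
  have hpos : ∀ n : ℕ, 0 < α ^ n := fun n => pow_pos hα0 n
  obtain ⟨D, hD⟩ : ∃ D : ℝ, ∀ n, dist (⟨f^[n] z, hf.iterate_im_pos hz n⟩ : ℍ)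
        ⟨Complex.I * (α ^ n : ℝ), I_mul_pow_im_pos hα n⟩ ≤ D :=
    ⟨_, fun n => (hf.dist_iterate_le hz n).trans (add_le_add_right
      (hs.sum_le_tsum (Finset.range n) fun k _ => div_nonneg (norm_nonneg _) (hpos k).le) _)⟩
  set E := Real.exp D with hE
  have hE0 : 0 < E := Real.exp_pos D
  have hbound : ∀ n : ℕ, ‖f (f^[n] z) - α * f^[n] z‖
      ≤ (E ^ 3 + 3) * ‖f (Complex.I * (α ^ n : ℝ)) - α * (Complex.I * (α ^ n : ℝ))‖ := by
    intro n
    have hζ := I_mul_pow_im_pos hα n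
    have hn := hpos n
    have h1 : ‖f^[n] z - Complex.I * (α ^ n : ℝ)‖ ≤ α ^ n * E := by
      have h := UpperHalfPlane.dist_coe_le (⟨f^[n] z, hf.iterate_im_pos hz n⟩ : ℍ)
        ⟨Complex.I * (α ^ n : ℝ), hζ⟩
      rw [Complex.dist_eq] at h
      refine h.trans ?_
      have him : (⟨Complex.I * (α ^ n : ℝ), hζ⟩ : ℍ).im = α ^ n := by
        change (Complex.I * ((α ^ n : ℝ) : ℂ)).im = α ^ n
        rw [Complex.I_mul_im, Complex.ofReal_re]
      rw [him]
      have := Real.exp_le_exp.2 (hD n)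
      gcongr
      linarith
    have h2 : α ^ n ≤ (f^[n] z).im * E := by
      have h := UpperHalfPlane.im_le_im_mul_exp_dist (⟨Complex.I * (α ^ n : ℝ), hζ⟩ : ℍ)
        ⟨f^[n] z, hf.iterate_im_pos hz n⟩
      rw [dist_comm] at h
      change (Complex.I * ((α ^ n : ℝ) : ℂ)).im ≤ (f^[n] z).im * _ at h
      rw [Complex.I_mul_im, Complex.ofReal_re] at h
      exact h.trans (mul_le_mul_of_nonneg_left (Real.exp_le_exp.2 (hD n))
        (hf.iterate_im_pos hz n).le)
    -- The constant `E ^ 3` is `E ^ 2` from the squared distance times `E` from comparing `αⁿ` with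
    -- `Im fⁿ(z)`.
    have h3 := (harnack_of_im_nonneg hf.im_sub_nonneg hf.differentiableOn_sub
      (hf.iterate_im_pos hz n) hζ (M := E ^ 3) (by positivity) (by
        rw [Complex.I_mul_im, Complex.ofReal_re]
        calc _ ≤ (α ^ n * E) ^ 2 := by gcongr
          _ = α ^ n * (α ^ n * E ^ 2) := by ring
          _ ≤ (f^[n] z).im * E * (α ^ n * E ^ 2) := by gcongr
          _ = _ := by ring)).2
    have h4 := norm_le_norm_add_norm_sub' (f (f^[n] z) - α * f^[n] z)
      (f (Complex.I * (α ^ n : ℝ)) - α * (Complex.I * (α ^ n : ℝ)))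
    have h5 := mul_le_mul_of_nonneg_left ((le_abs_self _).trans (Complex.abs_im_le_norm
      (f (Complex.I * (α ^ n : ℝ)) - α * (Complex.I * (α ^ n : ℝ)))))
      (by positivity : 0 ≤ E ^ 3 + 2)
    linarith
  have hc : CauchySeq fun n : ℕ => f^[n] z / (α : ℂ) ^ n := by
    refine cauchySeq_of_dist_le_of_summable _ (fun n => ?_) (hs.mul_left (E ^ 3 + 3))
    rw [dist_comm, Complex.dist_eq, iterate_succ_div_pow_sub hα, norm_div, norm_pow,
      Complex.norm_real, Real.norm_of_nonneg hα0.le, ← mul_div_assoc]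
    exact div_le_div₀ (by positivity) (hbound n) (hpos n) (pow_le_pow_right₀ hα.le n.le_succ)
  obtain ⟨L, hL⟩ := cauchySeq_tendsto_of_complete hc
  refine ⟨L, ?_, hL⟩
  -- The imaginary parts of the normalised orbit are nondecreasing, which keeps the limit off the
  -- real line.
  have him : ∀ n : ℕ, z.im ≤ (f^[n] z / (α : ℂ) ^ n).im := by
    intro n
    induction n with
    | zero => simp
    | succ n ih =>
      have h := congrArg Complex.im (iterate_succ_div_pow_sub (f := f) hα z n)
      rw [Complex.sub_im, im_div_ofReal_pow (f (f^[n] z) - _)] at h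
      have := div_nonneg (hf.im_sub_nonneg _ (hf.iterate_im_pos hz n)) (hpos (n + 1)).le
      linarith
  exact hz.trans_le (ge_of_tendsto' ((Complex.continuous_im.tendsto L).comp hL) him)

theorem IsHyperbolicAtInfty.summable_im_of_hasExtremalRateAt (hf : IsHyperbolicAtInfty f α)
    {z : ℂ} (hz : 0 < z.im) (h : HasExtremalRateAt f α z) :
    Summable fun n : ℕ =>
      (f (Complex.I * (α ^ n : ℝ)) - α * (Complex.I * (α ^ n : ℝ))).im / α ^ n := by
  have hα := hf.one_lt
  have hα0 : 0 < α := by linarith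
  have hpos : ∀ n : ℕ, 0 < α ^ n := fun n => pow_pos hα0 n
  obtain ⟨L, hL0, hL⟩ := h
  have hLim : 0 < L.im := hL0
  have himL : Tendsto (fun n : ℕ => (f^[n] z / (α : ℂ) ^ n).im) atTop (𝓝 L.im) :=
    (Complex.continuous_im.tendsto L).comp hL
  have hp0 : ∀ n : ℕ, 0 ≤ (f (f^[n] z) - α * f^[n] z).im := fun n =>
    hf.im_sub_nonneg _ (hf.iterate_im_pos hz n)
  -- The series has nonnegative terms and telescopes to the convergent sequence `Im (fⁿ(z) / αⁿ)`.
  have hsum : Summable fun n : ℕ => (f (f^[n] z) - α * f^[n] z).im / α ^ (n + 1) := by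
    have ht : ∀ n : ℕ, ∑ k ∈ Finset.range n, (f (f^[k] z) - α * f^[k] z).im / α ^ (k + 1)
        = (f^[n] z / (α : ℂ) ^ n).im - (f^[0] z / (α : ℂ) ^ 0).im := by
      intro n
      rw [← Finset.sum_range_sub (fun n : ℕ => (f^[n] z / (α : ℂ) ^ n).im)]
      refine Finset.sum_congr rfl fun k _ => ?_
      rw [← Complex.sub_im, iterate_succ_div_pow_sub hα, im_div_ofReal_pow]
    refine ((hasSum_iff_tendsto_nat_of_nonneg (fun n => div_nonneg (hp0 n) (hpos _).le)
      (L.im - (f^[0] z / (α : ℂ) ^ 0).im)).2 ?_).summable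
    simp_rw [ht]
    exact himL.sub_const _
  -- This ratio is scale-invariant in the pair `(i αⁿ, fⁿ z)`; it is bounded since `L` lies in the
  -- open half-plane, and its bound feeds Harnack.
  have hratio : Tendsto (fun n : ℕ => ‖Complex.I - f^[n] z / (α : ℂ) ^ n‖ ^ 2 /
      (f^[n] z / (α : ℂ) ^ n).im) atTop (𝓝 (‖Complex.I - L‖ ^ 2 / L.im)) :=
    (((hL.const_sub _).norm).pow 2).div himL hLim.ne'
  obtain ⟨M, hM⟩ := hratio.bddAbove_range
  have hM' : ∀ n : ℕ, ‖Complex.I * (α ^ n : ℝ) - f^[n] z‖ ^ 2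
      ≤ max M 0 * ((Complex.I * ((α ^ n : ℝ) : ℂ)).im * (f^[n] z).im) := by
    intro n
    have hn := hpos n
    have hzn := hf.iterate_im_pos hz n
    have h1 := (hM (Set.mem_range_self n)).trans (le_max_left M 0)
    rw [im_div_ofReal_pow, div_le_iff₀ (by positivity)] at h1
    have hne : (α : ℂ) ^ n ≠ 0 := pow_ne_zero _ (by exact_mod_cast hα0.ne')
    have e : Complex.I * ((α ^ n : ℝ) : ℂ) - f^[n] z
        = (Complex.I - f^[n] z / (α : ℂ) ^ n) * ((α ^ n : ℝ) : ℂ) := by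
      push_cast
      field_simp
    rw [e, norm_mul, Complex.norm_real, Real.norm_of_nonneg hn.le, mul_pow, Complex.I_mul_im,
      Complex.ofReal_re]
    calc _ ≤ max M 0 * ((f^[n] z).im / α ^ n) * (α ^ n) ^ 2 := by gcongr
      _ = _ := by field_simp
  refine Summable.of_nonneg_of_le
    (fun n => div_nonneg (hf.im_sub_nonneg _ (I_mul_pow_im_pos hα n)) (hpos n).le)
    (fun n => ?_) (hsum.mul_left ((max M 0 + 2) * α))
  have h1 := (harnack_of_im_nonneg hf.im_sub_nonneg hf.differentiableOn_sub
    (I_mul_pow_im_pos hα n) (hf.iterate_im_pos hz n) (le_max_right M 0) (hM' n)).1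
  have hn := hpos n
  rw [div_le_iff₀ hn]
  refine h1.trans (le_of_eq ?_)
  rw [pow_succ]
  field_simp

end Orbits

/-! ### The cycle of implications -/

theorem theorem6p3 (f : ℂ → ℂ) (α : ℝ) (hf : IsHyperbolicAtInfty f α) :
    List.TFAE [
      IsOfExtremalRate f α,
      ∀ z ∈ upperHalfPlaneSet, HasExtremalRateAt f α z,
      IntegrableOn
        (fun y : ℝ => ‖(f (Complex.I * y) - Complex.I * α * y) / (y : ℂ) ^ 2‖) (Set.Ioi 1),
      IntegrableOn
        (fun y : ℝ => ((f (Complex.I * y)).im - α * y) / y ^ 2) (Set.Ioi 1)] := by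
  have hm := hf.im_sub_nonneg
  have hd := hf.differentiableOn_sub
  have hα := hf.one_lt
  have e1 : (fun y : ℝ => ‖(f (Complex.I * y) - Complex.I * α * y) / (y : ℂ) ^ 2‖)
      = fun y : ℝ => ‖(f (Complex.I * y) - α * (Complex.I * y)) / (y : ℂ) ^ 2‖ := by
    funext y
    congr 3
    ring
  have e2 : (fun y : ℝ => ((f (Complex.I * y)).im - α * y) / y ^ 2)
      = fun y : ℝ => (f (Complex.I * y) - α * (Complex.I * y)).im / y ^ 2 := by
    funext y
    simp
  rw [e1, e2]
  tfae_have 1 → 3 := fun ⟨z, hz, h⟩ =>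
    integrableOn_norm_of_summable_im (p := fun z => f z - α * z) hm hd hα
      (hf.summable_im_of_hasExtremalRateAt hz h)
  tfae_have 3 → 4 := integrableOn_im_of_integrableOn_norm (p := fun z => f z - α * z) hd
  tfae_have 4 → 2 := fun h z hz => hf.hasExtremalRateAt_of_summable
    (summable_norm_of_summable_im (p := fun z => f z - α * z) hm hd hα
      (summable_im_of_integrableOn (p := fun z => f z - α * z) hm hd hα h)) hz
  tfae_have 2 → 1 := fun h => ⟨Complex.I, by simp [upperHalfPlaneSet], h _
    (by simp [upperHalfPlaneSet])⟩
  tfae_finish
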